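/- Fix $\varepsilon\in(0,1/24)$ and let $p=p(n)\in[0,1]$ satisfy $n^{5/8+\varepsilon}\le np$ for all sufficiently large $n$ and $np=o(n^{2/3})$ as $n\to\infty$. Set $$k=k(n)=\left\lceil 15\,p^{-2}\,(n^{-1}\log n)^{1/2}\right\rceil ,\qquad z_\ell=n-(\ell-1)np+\tfrac12(\ell-1)(\ell-2)np^2\quad(1\le \ell\le 2k).$$ For every $n$, let $Z_1,\dots,Z_{2k}$ be independent random variables such that $Z_\ell$ has the binomial distribution with parameters $z_\ell$ and $p$, where each $z_\ell$ is rounded up or down (in any way) to an integer. Let $Z^{(1)}=\max\{Z_\ell:1\le\ell\le 2k\}$. Then $$\frac{Z^{(1)}-np}{\sqrt{np\,\log\left(1/(np^3)\right)}}\longrightarrow 1\quad\text{in probability as } n\to\infty,$$ that is, for every $\delta>0$, the probability that the left-hand side differs from $1$ by at least $\delta$ tends to $0$ as $n\to\infty$. -/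

import Mathlib

open Filter Topology MeasureTheory Asymptotics

namespace MaxBinomial

/-- The number `k = ⌈15 p⁻² (n⁻¹ log n)^{1/2}⌉`, as a function of `n` and `p`. -/
noncomputable def k (n : ℕ) (p : ℝ) : ℕ :=
  ⌈15 * (p ^ 2)⁻¹ * √((n : ℝ)⁻¹ * Real.log n)⌉₊

/-- The real number `z_ℓ = n - (ℓ - 1) n p + (ℓ - 1) (ℓ - 2) n p² / 2`. All operations are in `ℝ`. -/
noncomputable def z (n : ℕ) (p : ℝ) (ℓ : ℕ) : ℝ :=
  (n : ℝ) - ((ℓ : ℝ) - 1) * n * p + 1 / 2 * ((ℓ : ℝ) - 1) * ((ℓ : ℝ) - 2) * n * p ^ 2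

/-- The integer `m` is the real number `x ≥ 0` rounded up or down. -/
def IsRounding (m : ℕ) (x : ℝ) : Prop :=
  m = ⌊x⌋₊ ∨ m = ⌈x⌉₊

/-- The maximum of `Z 1, …, Z m` (with value `0` in the degenerate case `m = 0`). -/
def maxUpTo {Ω : Type*} (m : ℕ) (Z : ℕ → Ω → ℕ) (ω : Ω) : ℕ :=
  (Finset.Icc 1 m).sup fun ℓ => Z ℓ ω

/-- Convergence in probability to a constant `c` of a sequence of real random variables `X n`,
each of which may live on its own probability space `(Ω n, P n)`. -/
def TendstoInProbability {Ω : ℕ → Type*} [∀ n, MeasurableSpace (Ω n)]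
    (P : ∀ n, Measure (Ω n)) (X : ∀ n, Ω n → ℝ) (c : ℝ) : Prop :=
  ∀ δ : ℝ, 0 < δ → Tendsto (fun n => P n {ω | δ ≤ |X n ω - c|}) atTop (𝓝 0)

end MaxBinomial

/-! Write `μ = np`, `L = log (1/(np³))` and `τ = √(L/μ)`. The normaliser is then `√(μL) = μτ`, and
`p√μ = exp (-L/2)`. The bound `np = o(n^{2/3})` gives `L → ∞`; the lower bound on `np` gives `np² →
∞`, hence `τ → 0`, so deviations of size `μτ` are moderate and have Gaussian exponent `L/2`.

The mean of `Z_ℓ` drops by order `μp` per step, so Chernoff at `τ` loses a further factor `exp (-q)`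
per step, `q = μpτ/2`. The union bound is a geometric series worth about `1/q ≲ exp (L/2)`, which
balances `exp (-L/2)` and leaves `exp (-δL)` (`measureReal_le_maxUpTo_le`).

Conversely, the first `exp (L/2)` variables have means within about `√μ` of `μ`. Each exceeds `μ +
(1 - 3h)μτ` with probability at least `exp (-L/2 + hL/2)/2` (`le_binomial_tail`), so by independence
they all fail with probability at most `exp (-exp (hL/2)/4)` (`measureReal_maxUpTo_lt_le`). -/

namespace ProbabilityTheory

/-! ### Binomial moment generating functions and tails. -/

lemma mgf_binomial (N : ℕ) (p : unitInterval) (t : ℝ) :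
    mgf (fun x : ℕ => (x : ℝ)) (binomial N p) t = (1 - p + p * Real.exp t) ^ N := by
  rw [mgf, integral_binomial, add_comm, add_pow]
  refine Finset.sum_congr (by ext; simp) fun j _ => ?_
  rw [mul_comm t, Real.exp_nat_mul, smul_eq_mul, mul_pow]
  ring

lemma mgf_binomial_le (N : ℕ) (p : unitInterval) (t : ℝ) :
    mgf (fun x : ℕ => (x : ℝ)) (binomial N p) t ≤ Real.exp (N * p * (Real.exp t - 1)) := by
  rw [mgf_binomial, mul_assoc, Real.exp_nat_mul]
  have h0 := p.2.1
  have h1 := p.2.2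
  refine pow_le_pow_left₀ ?_ ?_ N
  · have := Real.exp_pos t
    nlinarith
  · have := Real.add_one_le_exp ((p : ℝ) * (Real.exp t - 1))
    linarith

lemma exp_sub_sq_le_one_add {x : ℝ} (hx : 0 ≤ x) : Real.exp (x - x ^ 2) ≤ 1 + x := by
  rw [← Real.le_log_iff_exp_le (by linarith)]
  have h := Real.one_sub_inv_le_log_of_pos (show 0 < 1 + x by linarith)
  have h2 : x - x ^ 2 ≤ 1 - (1 + x)⁻¹ := by
    rw [le_sub_iff_add_le, ← le_sub_iff_add_le', inv_le_iff_one_le_mul₀ (by linarith)]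
    nlinarith [pow_nonneg hx 3]
  linarith

lemma le_mgf_binomial (N : ℕ) (p : unitInterval) {t : ℝ} (ht : 0 ≤ t) :
    Real.exp (N * p * (Real.exp t - 1) - N * p ^ 2 * (Real.exp t - 1) ^ 2) ≤
      mgf (fun x : ℕ => (x : ℝ)) (binomial N p) t := by
  rw [mgf_binomial]
  have h0 := p.2.1
  have hu : 0 ≤ Real.exp t - 1 := by linarith [Real.add_one_le_exp t]
  calc _ = Real.exp ((p : ℝ) * (Real.exp t - 1) - ((p : ℝ) * (Real.exp t - 1)) ^ 2) ^ N := by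
        rw [← Real.exp_nat_mul]; ring_nf
    _ ≤ (1 + (p : ℝ) * (Real.exp t - 1)) ^ N :=
        pow_le_pow_left₀ (Real.exp_pos _).le (exp_sub_sq_le_one_add (mul_nonneg h0 hu)) N
    _ = _ := by ring_nf

/-- A lower bound for an upper tail in terms of the moment generating function alone. -/
lemma le_measureReal_of_mgf {Ω : Type*} [MeasurableSpace Ω] {P : Measure Ω} [IsFiniteMeasure P]
    {X : Ω → ℝ} (hX : Measurable X) (hint : ∀ t, Integrable (fun ω => Real.exp (t * X ω)) P)
    {a b θ η : ℝ} (hθ : 0 ≤ θ) (hη : 0 ≤ η) :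
    mgf X P θ - Real.exp (η * a) * mgf X P (θ - η) - Real.exp (-(η * b)) * mgf X P (θ + η) ≤
      Real.exp (θ * b) * P.real {ω | a ≤ X ω} := by
  have hm : MeasurableSet {ω | a ≤ X ω} := measurableSet_le measurable_const hX
  have hi : Integrable ({ω | a ≤ X ω}.indicator fun _ => Real.exp (θ * b)) P :=
    (integrable_const _).indicator hm
  have hA := (hint (θ - η)).const_mul (Real.exp (η * a))
  have hB := (hint (θ + η)).const_mul (Real.exp (-(η * b)))
  have hAB : Integrable (fun ω => Real.exp (η * a) * Real.exp ((θ - η) * X ω) +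
      Real.exp (-(η * b)) * Real.exp ((θ + η) * X ω)) P := hA.add hB
  -- Pointwise, tilting down by `η` covers `X < a`, tilting up covers `X > b`, and the indicator
  -- covers the window between.
  have key : mgf X P θ ≤ ∫ ω, (Real.exp (η * a) * Real.exp ((θ - η) * X ω) +
      Real.exp (-(η * b)) * Real.exp ((θ + η) * X ω) +
      {ω | a ≤ X ω}.indicator (fun _ => Real.exp (θ * b)) ω) ∂P := by
    refine integral_mono (hint θ) (hAB.add hi) fun ω => ?_
    simp only [← Real.exp_add]
    have h1 := (Real.exp_pos (η * a + (θ - η) * X ω)).le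
    have h2 := (Real.exp_pos (-(η * b) + (θ + η) * X ω)).le
    by_cases ha : a ≤ X ω
    · have hind : {ω | a ≤ X ω}.indicator (fun _ => Real.exp (θ * b)) ω = Real.exp (θ * b) :=
        Set.indicator_of_mem (s := {ω | a ≤ X ω}) ha _
      rw [hind]
      rcases le_total (X ω) b with hb | hb
      · have : Real.exp (θ * X ω) ≤ Real.exp (θ * b) := Real.exp_le_exp.2 (by gcongr)
        linarith
      · have : Real.exp (θ * X ω) ≤ Real.exp (-(η * b) + (θ + η) * X ω) :=
          Real.exp_le_exp.2 (by nlinarith)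
        have := (Real.exp_pos (θ * b)).le
        linarith
    · have hind : {ω | a ≤ X ω}.indicator (fun _ => Real.exp (θ * b)) ω = 0 :=
        Set.indicator_of_notMem (s := {ω | a ≤ X ω}) ha _
      rw [hind]
      have : Real.exp (θ * X ω) ≤ Real.exp (η * a + (θ - η) * X ω) :=
        Real.exp_le_exp.2 (by nlinarith [not_le.1 ha])
      linarith
  rw [integral_add hAB hi, integral_add hA hB, integral_const_mul, integral_const_mul, integral_indicator_const _ hm, smul_eq_mul] at key
  simp only [mgf] at key ⊢
  linarith

lemma exp_sub_one_le {t : ℝ} (h0 : 0 ≤ t) (h1 : t ≤ 1) :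
    Real.exp t - 1 ≤ t + t ^ 2 / 2 + t ^ 3 := by
  have := Real.exp_bound' h0 h1 (n := 3) (by norm_num)
  simp [Finset.sum_range_succ, Nat.factorial] at this
  nlinarith [pow_nonneg h0 3]

lemma exp_sub_one_le_two_mul {t : ℝ} (h0 : 0 ≤ t) (h1 : t ≤ 1 / 2) :
    Real.exp t - 1 ≤ 2 * t := by
  nlinarith [exp_sub_one_le h0 (by linarith), pow_nonneg h0 3, mul_nonneg h0 h0]

/-- Upper bound for the moment generating function of a binomial variable of mean roughly `μ` in
the moderate deviation regime. -/
lemma mgf_binomial_le_of_le {N : ℕ} {p : unitInterval} {μ τ y : ℝ} (hμ : 0 ≤ μ)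
    (hN : (N : ℝ) * p ≤ μ + 1) (hτ0 : 0 ≤ τ) (hτ : τ ≤ 1 / 2) (hy0 : 0 ≤ y) (hy1 : y ≤ 1) :
    mgf (fun x : ℕ => (x : ℝ)) (binomial N p) (y * τ) ≤
      Real.exp (y * τ * μ + y ^ 2 / 2 * (μ * τ ^ 2) + (μ * τ ^ 2 * τ + 2 * τ)) := by
  refine (mgf_binomial_le N p _).trans (Real.exp_le_exp.2 ?_)
  have ht0 : 0 ≤ y * τ := by positivity
  have ht1 : y * τ ≤ τ := by nlinarith
  have hu := exp_sub_one_le ht0 (by linarith)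
  have hu2 := exp_sub_one_le_two_mul ht0 (by linarith)
  have hu0 : 0 ≤ Real.exp (y * τ) - 1 := by linarith [Real.add_one_le_exp (y * τ)]
  have hcube : (y * τ) ^ 3 ≤ τ ^ 3 := by gcongr
  calc _ ≤ (μ + 1) * (Real.exp (y * τ) - 1) := by gcongr
    _ = μ * (Real.exp (y * τ) - 1) + (Real.exp (y * τ) - 1) := by ring
    _ ≤ μ * (y * τ + (y * τ) ^ 2 / 2 + τ ^ 3) + 2 * τ := by
      gcongr
      · linarith
      · linarith
    _ = _ := by ring

/-- Lower bound for the moment generating function of a binomial variable of mean roughly `μ` in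
the moderate deviation regime. -/
lemma le_mgf_binomial_of_le {N : ℕ} {p : unitInterval} {μ τ y : ℝ} (hμ : 1 ≤ μ)
    (hN : (N : ℝ) * p ≤ μ + 1) (hN' : μ - √μ - 1 ≤ (N : ℝ) * p) (hτ0 : 0 ≤ τ) (hτ : τ ≤ 1 / 2)
    (hy0 : 0 ≤ y) (hy1 : y ≤ 1) :
    Real.exp (y * τ * μ + y ^ 2 / 2 * (μ * τ ^ 2)
        - (4 * √(μ * τ ^ 2) + 8 * p * (μ * τ ^ 2))) ≤
      mgf (fun x : ℕ => (x : ℝ)) (binomial N p) (y * τ) := by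
  have ht0 : 0 ≤ y * τ := by positivity
  refine le_trans (Real.exp_le_exp.2 ?_) (le_mgf_binomial N p ht0)
  have hp0 := p.2.1
  have ht1 : y * τ ≤ τ := by nlinarith
  have hu2 := exp_sub_one_le_two_mul ht0 (by linarith)
  have hu1 : y * τ + (y * τ) ^ 2 / 2 ≤ Real.exp (y * τ) - 1 := by
    linarith [Real.quadratic_le_exp_of_nonneg ht0]
  have hu0 : 0 ≤ Real.exp (y * τ) - 1 := by linarith [Real.add_one_le_exp (y * τ)]
  set u := Real.exp (y * τ) - 1
  have hu3 : u ≤ 2 * τ := by linarith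
  have hs : √(μ * τ ^ 2) = √μ * τ := by
    rw [Real.sqrt_mul (by linarith), Real.sqrt_sq hτ0]
  have hs1 : 1 ≤ √μ := Real.one_le_sqrt.2 hμ
  -- Two losses: the mean deficit `√μ + 1` costs `4√μ τ`, and the second-order term costs `8pμτ²`.
  have e1 : (μ - √μ - 1) * u ≤ N * p * u := by gcongr
  have e2 : N * (p : ℝ) ^ 2 * u ^ 2 ≤ (2 * μ) * p * (2 * τ) ^ 2 := by
    have : N * (p : ℝ) ^ 2 = N * p * p := by ring
    rw [this]
    exact mul_le_mul (mul_le_mul_of_nonneg_right (by linarith) hp0)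
      (pow_le_pow_left₀ hu0 hu3 2) (by positivity) (by positivity)
  have e3 : (√μ + 1) * u ≤ (2 * √μ) * (2 * τ) := by
    gcongr
    linarith
  have e4 : μ * (y * τ + (y * τ) ^ 2 / 2) ≤ μ * u := by gcongr
  rw [hs]
  nlinarith

/-- Moderate deviation lower bound for the upper tail of a binomial variable. -/
lemma le_binomial_tail {N : ℕ} {p : unitInterval} {μ τ L h : ℝ} (hμ : 1 ≤ μ)
    (hN : (N : ℝ) * p ≤ μ + 1) (hN' : μ - √μ - 1 ≤ (N : ℝ) * p) (hτ0 : 0 ≤ τ) (hτ : τ ≤ 1 / 2)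
    (hL : L = μ * τ ^ 2) (hh0 : 0 < h) (hh : h ≤ 1 / 3) (hLh : 8 ≤ L * h ^ 2)
    (hup : L * τ + 2 * τ ≤ h ^ 2 / 8 * L) (hlow : 4 * √L + 8 * p * L ≤ h ^ 2 / 8 * L) :
    Real.exp (-L / 2 + h * L / 2) / 2 ≤
      (binomial N p).real {x : ℕ | μ + (1 - 3 * h) * (μ * τ) ≤ x} := by
  have hL0 : 0 ≤ L := by rw [hL]; positivity
  set M := mgf (fun x : ℕ => (x : ℝ)) (binomial N p)
  have hup' : ∀ y, 0 ≤ y → y ≤ 1 →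
      M (y * τ) ≤ Real.exp (y * τ * μ + y ^ 2 / 2 * L + h ^ 2 / 8 * L) := fun y h0 h1 => by
    refine (mgf_binomial_le_of_le (by linarith) hN hτ0 hτ h0 h1).trans (Real.exp_le_exp.2 ?_)
    rw [← hL]
    linarith
  have hc : Real.exp ((1 - 2 * h) * τ * μ + (1 - 2 * h) ^ 2 / 2 * L - h ^ 2 / 8 * L) ≤
      M ((1 - 2 * h) * τ) := by
    refine le_trans (Real.exp_le_exp.2 ?_)
      (le_mgf_binomial_of_le hμ hN hN' hτ0 hτ (by linarith) (by linarith))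
    rw [← hL]
    linarith
  have h1 := hup' (1 - 3 * h) (by linarith) (by linarith)
  have h2 := hup' (1 - h) (by linarith) (by linarith)
  -- Each shifted tilt loses `h²L/2` against the central one; the two errors `h²L/8` leave `h²L/4`,
  -- so each side takes at most a quarter of `Q`.
  have h8 : (4 : ℝ) ≤ Real.exp (h ^ 2 / 4 * L) := by
    refine le_trans ?_ (Real.quadratic_le_exp_of_nonneg (by positivity))
    nlinarith
  set Q := Real.exp ((1 - 2 * h) * τ * μ + (1 - 2 * h) ^ 2 / 2 * L - h ^ 2 / 8 * L)
  -- The law tilted by `(1 - 2h)τ` is centred near `μ + (1 - 2h)μτ`, the midpoint of the window.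
  have key := le_measureReal_of_mgf (P := binomial N p) (X := fun x : ℕ => (x : ℝ))
    (a := μ + (1 - 3 * h) * (μ * τ)) (b := μ + (1 - h) * (μ * τ)) (θ := (1 - 2 * h) * τ)
    (η := h * τ) (by fun_prop) (fun t => integrable_binomial _)
    (mul_nonneg (by linarith) hτ0) (by positivity)
  have r1 : Real.exp (h * τ * (μ + (1 - 3 * h) * (μ * τ))) * M ((1 - 2 * h) * τ - h * τ) ≤
      Q / 4 := by
    rw [le_div_iff₀ (by norm_num)]
    calc _ ≤ Real.exp (h * τ * (μ + (1 - 3 * h) * (μ * τ))) *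
          Real.exp ((1 - 3 * h) * τ * μ + (1 - 3 * h) ^ 2 / 2 * L + h ^ 2 / 8 * L) *
          Real.exp (h ^ 2 / 4 * L) := by
            gcongr
            rwa [show (1 - 2 * h) * τ - h * τ = (1 - 3 * h) * τ by ring]
      _ = Q := by
        simp only [Q]
        rw [← Real.exp_add, ← Real.exp_add, hL]
        congr 1
        ring
  have r2 : Real.exp (-(h * τ * (μ + (1 - h) * (μ * τ)))) * M ((1 - 2 * h) * τ + h * τ) ≤
      Q / 4 := by
    rw [le_div_iff₀ (by norm_num)]
    calc _ ≤ Real.exp (-(h * τ * (μ + (1 - h) * (μ * τ)))) *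
          Real.exp ((1 - h) * τ * μ + (1 - h) ^ 2 / 2 * L + h ^ 2 / 8 * L) *
          Real.exp (h ^ 2 / 4 * L) := by
            gcongr
            rwa [show (1 - 2 * h) * τ + h * τ = (1 - h) * τ by ring]
      _ = Q := by
        simp only [Q]
        rw [← Real.exp_add, ← Real.exp_add, hL]
        congr 1
        ring
  have r3 : Q / 2 ≤ Real.exp ((1 - 2 * h) * τ * (μ + (1 - h) * (μ * τ))) *
      (binomial N p).real {x : ℕ | μ + (1 - 3 * h) * (μ * τ) ≤ x} := by linarith
  rw [← div_le_iff₀' (Real.exp_pos _)] at r3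
  refine le_trans ?_ r3
  rw [div_right_comm, ← Real.exp_sub]
  gcongr
  have : h ^ 2 * L ≤ h * L / 3 := by nlinarith [mul_nonneg hh0.le hL0]
  have e : (1 - 2 * h) * τ * μ + (1 - 2 * h) ^ 2 / 2 * L - h ^ 2 / 8 * L -
      (1 - 2 * h) * τ * (μ + (1 - h) * (μ * τ)) = -L / 2 + h * L - h ^ 2 / 8 * L := by
    rw [hL]; ring
  rw [e]
  linarith [mul_nonneg hh0.le hL0]

end ProbabilityTheory

/-! ### Bounds for the maximum at fixed `n`. -/

namespace MaxBinomial

open ProbabilityTheory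

lemma IsRounding.bounds {m : ℕ} {x : ℝ} (hx : 0 ≤ x) (h : IsRounding m x) :
    x - 1 ≤ m ∧ (m : ℝ) ≤ x + 1 := by
  rcases h with rfl | rfl
  · exact ⟨(Nat.sub_one_lt_floor x).le, by linarith [Nat.floor_le hx]⟩
  · exact ⟨by linarith [Nat.le_ceil x], (Nat.ceil_lt_add_one hx).le⟩

/-- Bounds for the mean of the `ℓ`-th binomial variable, where `ℓ = j + 1`. -/
lemma IsRounding.mean_bounds {n j N : ℕ} {p : unitInterval}
    (hp : ((j : ℝ) + 1) * p ≤ 1) (h : IsRounding N (z n p (j + 1))) :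
    n * (p : ℝ) - j * (n * p * p) - 1 ≤ (N : ℝ) * p ∧
      (N : ℝ) * p ≤ n * (p : ℝ) - j * (n * p * p / 2) + 1 := by
  have hp0 := p.2.1
  have hp1 := p.2.2
  have hz1 : (n : ℝ) - j * (n * p) ≤ z n p (j + 1) := by
    have : (0 : ℝ) ≤ j * (j - 1) := by
      rcases Nat.eq_zero_or_pos j with rfl | hj
      · simp
      · have : (1 : ℝ) ≤ j := by exact_mod_cast hj
        exact mul_nonneg (by linarith) (by linarith)
    have : 0 ≤ (j * (j - 1) : ℝ) * (n * p ^ 2) := by positivity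
    simp only [z]
    push_cast
    linarith
  -- As `(j - 1)p ≤ 1`, the quadratic term cancels at most half of the linear one.
  have hz2 : z n p (j + 1) ≤ (n : ℝ) - j * (n * p / 2) := by
    have : (0 : ℝ) ≤ j * (n * p) * (1 - (j - 1) * p) :=
      mul_nonneg (by positivity) (by linarith)
    simp only [z]
    push_cast
    linarith
  have hz0 : 0 ≤ z n p (j + 1) := by
    refine le_trans ?_ hz1
    have : (0 : ℝ) ≤ n * (1 - j * p) := mul_nonneg (by positivity) (by linarith)
    linarith
  obtain ⟨h1, h2⟩ := h.bounds hz0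
  constructor
  · have := mul_le_mul_of_nonneg_right (hz1.trans (sub_le_iff_le_add.1 h1)) hp0
    linarith
  · have := mul_le_mul_of_nonneg_right (h2.trans (add_le_add_left hz2 1)) hp0
    linarith

lemma geom_sum_exp_neg_le {q : ℝ} (hq : 0 < q) (K : ℕ) :
    ∑ j ∈ Finset.range K, Real.exp (-q) ^ j ≤ 1 + 1 / q := by
  have h1 := geom_sum_mul_neg (Real.exp (-q)) K
  have h2 : Real.exp (-q) ≤ 1 / (1 + q) := by
    rw [Real.exp_neg, ← one_div]
    exact one_div_le_one_div_of_le (by linarith) (by linarith [Real.add_one_le_exp q])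
  have h3 : q / (1 + q) ≤ 1 - Real.exp (-q) := by
    have : q / (1 + q) = 1 - 1 / (1 + q) := by field_simp; ring
    linarith
  have h4 : 0 ≤ ∑ j ∈ Finset.range K, Real.exp (-q) ^ j := by positivity
  have h5 : (∑ j ∈ Finset.range K, Real.exp (-q) ^ j) * (q / (1 + q)) ≤ 1 :=
    (mul_le_mul_of_nonneg_left h3 h4).trans (by rw [h1]; linarith [pow_pos (Real.exp_pos (-q)) K])
  rw [← le_div_iff₀ (by positivity)] at h5
  refine h5.trans (le_of_eq ?_)
  field_simp
  ring

section FixedN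

variable {Ω : Type*} [MeasurableSpace Ω] {P : Measure Ω} [IsProbabilityMeasure P]
  {n K : ℕ} {p : unitInterval} {N : ℕ → ℕ} {Z : ℕ → Ω → ℕ} {μ τ L : ℝ}

lemma measureReal_le_maxUpTo_le
    (hN : ∀ ℓ ∈ Finset.Icc 1 K, IsRounding (N ℓ) (z n p ℓ))
    (hZ : ∀ ℓ ∈ Finset.Icc 1 K, HasLaw (Z ℓ) (binomial (N ℓ) p) P)
    (hK : (K : ℝ) * p ≤ 1) (hμ : μ = n * p) (hμ0 : 0 < μ) (hτ0 : 0 < τ) (hτ : τ ≤ 1 / 2)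
    (hL : L = μ * τ ^ 2) (hL1 : 1 ≤ L) (hpμ : p * √μ = Real.exp (-(L / 2)))
    {δ : ℝ} (hδ : 0 < δ) :
    P.real {ω | μ + (1 + δ) * (μ * τ) ≤ maxUpTo K Z ω} ≤
      3 * Real.exp (-(δ * L) + (L * τ + 2 * τ)) := by
  set a := μ + (1 + δ) * (μ * τ) with ha
  have ha0 : 0 < a := by positivity
  have hp0 := p.2.1
  set q := μ * p * τ / 2
  -- Indeed `q = p√μ · √L / 2`, and `L ≥ 1`.
  have hq : Real.exp (-(L / 2)) / 2 ≤ q := by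
    have e : q = p * √μ * √L / 2 := by
      rw [hL, Real.sqrt_mul hμ0.le, Real.sqrt_sq hτ0.le]
      linear_combination -(p * τ / 2 : ℝ) * Real.mul_self_sqrt hμ0.le
    rw [e, hpμ]
    have := Real.one_le_sqrt.2 hL1
    have := Real.exp_pos (-(L / 2))
    nlinarith
  have hq0 : 0 < q := lt_of_lt_of_le (by positivity) hq
  have tail : ∀ j ∈ Finset.range K, P.real {ω | a ≤ Z (j + 1) ω} ≤
      Real.exp (-(δ * L) - L / 2 + (L * τ + 2 * τ)) * Real.exp (-q) ^ j := fun j hj => by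
    have hjK : j + 1 ≤ K := Finset.mem_range.1 hj
    have hmem : j + 1 ∈ Finset.Icc 1 K := Finset.mem_Icc.2 ⟨by omega, hjK⟩
    have hjp : ((j : ℝ) + 1) * p ≤ 1 := by
      refine le_trans ?_ hK
      have : ((j : ℝ) + 1) ≤ K := by exact_mod_cast hjK
      gcongr
    have hb := ((hN _ hmem).mean_bounds hjp).2
    rw [(hZ _ hmem).measureReal_eq (p := fun x : ℕ => a ≤ x) (by measurability)]
    refine (measure_ge_le_exp_mul_mgf (X := fun x : ℕ => (x : ℝ)) a hτ0.le
      (integrable_binomial _)).trans ?_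
    refine (mul_le_mul_of_nonneg_left (mgf_binomial_le _ p τ) (Real.exp_pos _).le).trans ?_
    rw [← Real.exp_add, ← Real.exp_nat_mul, ← Real.exp_add]
    refine Real.exp_le_exp.2 ?_
    have hu0 : τ ≤ Real.exp τ - 1 := by linarith [Real.add_one_le_exp τ]
    have hu := exp_sub_one_le hτ0.le (by linarith)
    have hu2 := exp_sub_one_le_two_mul hτ0.le hτ
    have i1 : (N (j + 1) : ℝ) * p * (Real.exp τ - 1) ≤
        (μ - j * (μ * p / 2) + 1) * (Real.exp τ - 1) := by
      rw [hμ]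
      exact mul_le_mul_of_nonneg_right hb (by linarith)
    have i2 : μ * (Real.exp τ - 1) ≤ μ * (τ + τ ^ 2 / 2 + τ ^ 3) := by gcongr
    have i3 : j * (μ * p / 2) * τ ≤ j * (μ * p / 2) * (Real.exp τ - 1) := by gcongr
    have e1 : j * (μ * p / 2) * τ = j * q := by simp only [q]; ring
    rw [ha, hL]
    linarith
  have hsub : {ω | a ≤ maxUpTo K Z ω} ⊆ ⋃ j ∈ Finset.range K, {ω | a ≤ Z (j + 1) ω} := by
    intro ω hω
    simp only [Set.mem_ofPred_eq, maxUpTo] at hω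
    -- An empty supremum would be `0`, below `a > 0`.
    have hne : (Finset.Icc 1 K).Nonempty := by
      by_contra hne
      rw [Finset.not_nonempty_iff_eq_empty.1 hne] at hω
      simp at hω
      linarith
    obtain ⟨ℓ, hℓ, hs⟩ := Finset.exists_mem_eq_sup _ hne fun ℓ => Z ℓ ω
    rw [hs] at hω
    rw [Finset.mem_Icc] at hℓ
    simp only [Set.mem_iUnion, Finset.mem_range, Set.mem_ofPred_eq]
    exact ⟨ℓ - 1, by omega, by rwa [Nat.sub_add_cancel hℓ.1]⟩
  calc _ ≤ P.real (⋃ j ∈ Finset.range K, {ω | a ≤ Z (j + 1) ω}) :=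
        measureReal_mono hsub (measure_ne_top _ _)
    _ ≤ ∑ j ∈ Finset.range K, P.real {ω | a ≤ Z (j + 1) ω} :=
        measureReal_biUnion_finset_le _ _
    _ ≤ ∑ j ∈ Finset.range K,
        Real.exp (-(δ * L) - L / 2 + (L * τ + 2 * τ)) * Real.exp (-q) ^ j :=
        Finset.sum_le_sum tail
    _ ≤ Real.exp (-(δ * L) - L / 2 + (L * τ + 2 * τ)) * (3 * Real.exp (L / 2)) := by
        rw [← Finset.mul_sum]
        gcongr
        refine (geom_sum_exp_neg_le hq0 K).trans ?_
        have h1 : 1 / q ≤ 2 * Real.exp (L / 2) := by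
          refine (one_div_le_one_div_of_le (by positivity) hq).trans (le_of_eq ?_)
          rw [Real.exp_neg]
          field_simp
        have h2 : 1 ≤ Real.exp (L / 2) := Real.one_le_exp (by linarith)
        linarith
    _ = _ := by
        rw [mul_left_comm, ← Real.exp_add]
        ring_nf

lemma measureReal_maxUpTo_lt_le
    (hN : ∀ ℓ ∈ Finset.Icc 1 K, IsRounding (N ℓ) (z n p ℓ))
    (hZ : ∀ ℓ ∈ Finset.Icc 1 K, HasLaw (Z ℓ) (binomial (N ℓ) p) P)
    (hind : iIndepFun (fun ℓ : Finset.Icc 1 K => Z ℓ) P)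
    (hK : (K : ℝ) * p ≤ 1) (hμ : μ = n * p) (hμ1 : 1 ≤ μ) (hτ0 : 0 < τ) (hτ : τ ≤ 1 / 2)
    (hL : L = μ * τ ^ 2) (hL2 : 2 ≤ L) (hpμ : p * √μ = Real.exp (-(L / 2)))
    (hKL : Real.exp (L / 2) ≤ K)
    {h : ℝ} (hh0 : 0 < h) (hh : h ≤ 1 / 3) (hLh : 8 ≤ L * h ^ 2)
    (hup : L * τ + 2 * τ ≤ h ^ 2 / 8 * L) (hlow : 4 * √L + 8 * p * L ≤ h ^ 2 / 8 * L) :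
    P.real {ω | (maxUpTo K Z ω : ℝ) < μ + (1 - 3 * h) * (μ * τ)} ≤
      Real.exp (-(Real.exp (h * L / 2) / 4)) := by
  set a := μ + (1 - 3 * h) * (μ * τ)
  have hp0 := p.2.1
  have hE : 2 ≤ Real.exp (L / 2) := by linarith [Real.add_one_le_exp (L / 2)]
  set m := ⌊Real.exp (L / 2)⌋₊
  have hm1 : (m : ℝ) ≤ Real.exp (L / 2) := Nat.floor_le (Real.exp_pos _).le
  have hm2 : Real.exp (L / 2) - 1 < m := Nat.sub_one_lt_floor _
  have hmK : m ≤ K := by exact_mod_cast hm1.trans hKL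
  let g : Fin m → Finset.Icc 1 K := fun i =>
    ⟨i + 1, Finset.mem_Icc.2 ⟨by omega, by have := i.2; omega⟩⟩
  have hg : Function.Injective g := fun i j hij => by
    have : (i : ℕ) + 1 = j + 1 := congrArg Subtype.val hij
    exact Fin.ext (by omega)
  set q := Real.exp (-L / 2 + h * L / 2) / 2
  have each : ∀ i : Fin m, P.real (Z (i + 1) ⁻¹' {x : ℕ | (x : ℝ) < a}) ≤ Real.exp (-q) :=
    fun i => by
    have hmem : (i : ℕ) + 1 ∈ Finset.Icc 1 K := (g i).2
    have hiK : (i : ℕ) + 1 ≤ K := (Finset.mem_Icc.1 hmem).2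
    have hjp : ((i : ℕ) + 1 : ℝ) * p ≤ 1 := by
      refine le_trans ?_ hK
      have : ((i : ℕ) + 1 : ℝ) ≤ K := by exact_mod_cast hiK
      gcongr
    obtain ⟨hb1, hb2⟩ := (hN _ hmem).mean_bounds hjp
    rw [← hμ] at hb1 hb2
    have him : ((i : ℕ) : ℝ) ≤ Real.exp (L / 2) := by
      refine le_trans ?_ hm1
      exact_mod_cast i.2.le
    have hpp : 0 ≤ μ * p := by positivity
    -- This is why only `exp (L/2)` variables are kept: their means drop by at most one
    -- standard-deviation scale.
    have hmean : ((i : ℕ) : ℝ) * (μ * p) ≤ √μ := by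
      calc _ ≤ Real.exp (L / 2) * (μ * p) := by gcongr
        _ = Real.exp (L / 2) * (p * √μ) * √μ := by
            linear_combination -(Real.exp (L / 2) * p) * Real.mul_self_sqrt (by linarith : 0 ≤ μ)
        _ = √μ := by rw [hpμ, ← Real.exp_add]; simp
    have htail : q ≤ (binomial (N (i + 1)) p).real {x : ℕ | a ≤ (x : ℝ)} := le_binomial_tail (N := N (i + 1)) (p := p) hμ1
      (by nlinarith) (by linarith) hτ0.le hτ hL hh0 hh hLh hup hlow
    have hlaw : P.real (Z (i + 1) ⁻¹' {x : ℕ | (x : ℝ) < a}) =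
        (binomial (N (i + 1)) p).real {x : ℕ | (x : ℝ) < a} :=
      (hZ _ hmem).measureReal_eq (p := fun x : ℕ => (x : ℝ) < a) (by measurability)
    have hcompl : {x : ℕ | (x : ℝ) < a} = {x : ℕ | a ≤ (x : ℝ)}ᶜ := by ext; simp
    rw [hlaw, hcompl, probReal_compl_eq_one_sub (by measurability)]
    have := Real.add_one_le_exp (-q)
    linarith
  have hsub : {ω | (maxUpTo K Z ω : ℝ) < a} ⊆
      ⋂ i ∈ (Finset.univ : Finset (Fin m)), Z (i + 1) ⁻¹' {x : ℕ | (x : ℝ) < a} := by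
    intro ω hω
    simp only [Set.mem_iInter]
    intro i _
    refine lt_of_le_of_lt ?_ (show (maxUpTo K Z ω : ℝ) < a from hω)
    exact_mod_cast Finset.le_sup (f := fun ℓ => Z ℓ ω) (g i).2
  have hprod := (hind.precomp hg).measure_inter_preimage_eq_mul Finset.univ
    (sets := fun _ => {x : ℕ | (x : ℝ) < a}) (fun _ _ => by measurability)
  calc _ ≤ P.real (⋂ i ∈ (Finset.univ : Finset (Fin m)),
        Z (i + 1) ⁻¹' {x : ℕ | (x : ℝ) < a}) :=
        measureReal_mono hsub (measure_ne_top _ _)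
    _ = ∏ i : Fin m, P.real (Z (i + 1) ⁻¹' {x : ℕ | (x : ℝ) < a}) := by
        simp only [measureReal_def]
        rw [← ENNReal.toReal_prod]
        exact congrArg _ hprod
    _ ≤ ∏ _i : Fin m, Real.exp (-q) := by gcongr with i; exact each i
    _ = Real.exp (-(m * q)) := by
        rw [Finset.prod_const, Finset.card_univ, Fintype.card_fin, ← Real.exp_nat_mul]
        ring_nf
    _ ≤ _ := by
        refine Real.exp_le_exp.2 (neg_le_neg ?_)
        calc Real.exp (h * L / 2) / 4 = Real.exp (L / 2) / 2 * q := by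
              simp only [q]
              rw [div_mul_div_comm, ← Real.exp_add]
              ring_nf
          _ ≤ m * q := by
              have : 0 < q := by positivity
              gcongr
              linarith

end FixedN

end MaxBinomial

/-! ### Asymptotics of the parameters. -/

namespace MaxBinomial

lemma mul_sqrt_eq_sqrt_sq_mul {a : ℝ} (ha : 0 ≤ a) (b : ℝ) : a * √b = √(a ^ 2 * b) := by
  rw [Real.sqrt_mul (sq_nonneg a), Real.sqrt_sq ha]

lemma two_mul_k_le (n : ℕ) {p : ℝ} (hp : 0 < p) :
    ((2 * k n p : ℕ) : ℝ) * p ≤ 30 * √(Real.log n / (n * p ^ 2)) + 2 * p := by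
  have h := (Nat.ceil_lt_add_one
    (show 0 ≤ 15 * (p ^ 2)⁻¹ * √((n : ℝ)⁻¹ * Real.log n) by positivity)).le
  have e : √(Real.log n / (n * p ^ 2)) = p⁻¹ * √((n : ℝ)⁻¹ * Real.log n) := by
    rw [mul_sqrt_eq_sqrt_sq_mul (inv_pos.2 hp).le]
    congr 1
    field_simp
  have e2 : (p ^ 2)⁻¹ * p = p⁻¹ := by field_simp
  push_cast
  calc (2 * (k n p : ℝ)) * p ≤ (2 * (15 * (p ^ 2)⁻¹ * √((n : ℝ)⁻¹ * Real.log n) + 1)) * p := by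
        gcongr
        exact h
    _ = 30 * ((p ^ 2)⁻¹ * p) * √((n : ℝ)⁻¹ * Real.log n) + 2 * p := by ring
    _ = _ := by rw [e2, e]; ring

/-- The left side is `exp (L/2)`, so there are enough variables for the lower bound. -/
lemma sqrt_le_two_mul_k {n : ℕ} (hn : 1 ≤ Real.log n) {p : ℝ} (hp : 0 < p) (hp1 : p ≤ 1) :
    √(1 / (n * p ^ 3)) ≤ ((2 * k n p : ℕ) : ℝ) := by
  have h : 15 * (p ^ 2)⁻¹ * √((n : ℝ)⁻¹ * Real.log n) ≤ k n p := Nat.le_ceil _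
  have e : (p ^ 2)⁻¹ * √((n : ℝ)⁻¹ * Real.log n) = √(Real.log n / (n * p ^ 4)) := by
    rw [mul_sqrt_eq_sqrt_sq_mul (by positivity)]
    congr 1
    field_simp
  have le : √(1 / (n * p ^ 3)) ≤ √(Real.log n / (n * p ^ 4)) := by
    apply Real.sqrt_le_sqrt
    have : 1 / (n * p ^ 3) = p / (n * p ^ 4) := by field_simp
    rw [this]
    gcongr
    linarith
  have := Real.sqrt_nonneg (Real.log n / (n * p ^ 4))
  rw [mul_assoc, e] at h
  push_cast
  linarith

section Asymptotics

variable {ε : ℝ} {p : ℕ → unitInterval}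

lemma eventually_rpow_le_mul_sq (hε : 0 < ε)
    (hp : ∀ᶠ n : ℕ in atTop, (n : ℝ) ^ (5 / 8 + ε : ℝ) ≤ n * (p n : ℝ)) :
    ∀ᶠ n : ℕ in atTop, (n : ℝ) ^ (1 / 4 : ℝ) ≤ n * (p n : ℝ) ^ 2 := by
  filter_upwards [hp, eventually_ge_atTop 1] with n h hn
  have hn1 : (1 : ℝ) ≤ n := by exact_mod_cast hn
  have hn0 : (0 : ℝ) < n := by linarith
  have h1 : (n : ℝ) ^ (5 / 8 : ℝ) ≤ n * (p n : ℝ) :=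
    (Real.rpow_le_rpow_of_exponent_le hn1 (by linarith)).trans h
  have h2 : ((n : ℝ) ^ (5 / 8 : ℝ)) ^ 2 ≤ (n * (p n : ℝ)) ^ 2 := by gcongr
  have h3 : ((n : ℝ) ^ (5 / 8 : ℝ)) ^ 2 = n * (n : ℝ) ^ (1 / 4 : ℝ) := by
    rw [← Real.rpow_natCast, ← Real.rpow_mul hn0.le]
    nth_rw 2 [← Real.rpow_one (n : ℝ)]
    rw [← Real.rpow_add hn0]
    norm_num
  rw [h3, show (n * (p n : ℝ)) ^ 2 = n * (n * (p n : ℝ) ^ 2) by ring] at h2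
  exact le_of_mul_le_mul_left h2 hn0

lemma tendsto_mul_cube
    (hp : (fun n : ℕ => (n : ℝ) * (p n : ℝ)) =o[atTop] fun n : ℕ => (n : ℝ) ^ (2 / 3 : ℝ)) :
    Tendsto (fun n : ℕ => (n : ℝ) * (p n : ℝ) ^ 3) atTop (𝓝 0) := by
  refine ((hp.pow (show 0 < 3 by norm_num)).tendsto_div_nhds_zero).congr' ?_
  filter_upwards [eventually_ge_atTop 1] with n hn
  have hn0 : (0 : ℝ) < n := by exact_mod_cast hn
  rw [← Real.rpow_natCast ((n : ℝ) ^ (2 / 3 : ℝ)), ← Real.rpow_mul hn0.le]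
  norm_num
  field_simp

lemma tendsto_mul_sq (h : ∀ᶠ n : ℕ in atTop, (n : ℝ) ^ (1 / 4 : ℝ) ≤ n * (p n : ℝ) ^ 2) :
    Tendsto (fun n : ℕ => (n : ℝ) * (p n : ℝ) ^ 2) atTop atTop :=
  tendsto_atTop_mono' _ h
    ((tendsto_rpow_atTop (by norm_num)).comp tendsto_natCast_atTop_atTop)

/-- Supplies `2kp ≤ 1` eventually, as the bounds on the means require. -/
lemma tendsto_two_mul_k_mul (h : ∀ᶠ n : ℕ in atTop, (n : ℝ) ^ (1 / 4 : ℝ) ≤ n * (p n : ℝ) ^ 2)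
    (hp0 : ∀ᶠ n : ℕ in atTop, 0 < (p n : ℝ))
    (hp : Tendsto (fun n => (p n : ℝ)) atTop (𝓝 0)) :
    Tendsto (fun n => ((2 * k n (p n) : ℕ) : ℝ) * p n) atTop (𝓝 0) := by
  have hlog : Tendsto (fun n : ℕ => Real.log n / (n : ℝ) ^ (1 / 4 : ℝ)) atTop (𝓝 0) :=
    ((isLittleO_log_rpow_atTop (by norm_num)).tendsto_div_nhds_zero).comp
      tendsto_natCast_atTop_atTop
  have hlim : Tendsto (fun n : ℕ => 30 * √(Real.log n / (n : ℝ) ^ (1 / 4 : ℝ)) + 2 * (p n : ℝ))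
      atTop (𝓝 0) := by
    simpa using ((hlog.sqrt).const_mul 30).add (hp.const_mul 2)
  refine tendsto_of_tendsto_of_tendsto_of_le_of_le' tendsto_const_nhds hlim
    (Eventually.of_forall fun n => mul_nonneg (Nat.cast_nonneg _) (p n).2.1) ?_
  filter_upwards [h, hp0, eventually_ge_atTop 1] with n hn hpn hn1
  have hn0 : (0 : ℝ) < n := by exact_mod_cast hn1
  refine (two_mul_k_le n hpn).trans ?_
  have := Real.log_natCast_nonneg n
  gcongr

/-- The crude `log x ≤ x` already forces `τ → 0`. -/
lemma sqrt_log_div_le {n : ℕ} {p : ℝ} (hn : 0 < n) (hp : 0 < p) :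
    √(Real.log (1 / (n * p ^ 3)) / (n * p)) ≤ 1 / (n * p ^ 2) := by
  have hn0 : (0 : ℝ) < n := by exact_mod_cast hn
  refine Real.sqrt_le_iff.2 ⟨by positivity, ?_⟩
  have h := Real.log_le_self (show 0 ≤ 1 / (n * p ^ 3) by positivity)
  calc _ ≤ 1 / (n * p ^ 3) / (n * p) := by gcongr
    _ = _ := by field_simp

end Asymptotics

end MaxBinomial

/-! ### Choice of constants and conclusion. -/

theorem lemma3p17
    (ε : ℝ) (hε : ε ∈ Set.Ioo (0 : ℝ) (1 / 24))
    -- the edge probability `p = p(n)`, with `n^{5/8+ε} ≤ np ≪ n^{2/3}`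
    (p : ℕ → unitInterval)
    (hp_lower : ∀ᶠ n : ℕ in atTop, (n : ℝ) ^ (5 / 8 + ε : ℝ) ≤ n * (p n : ℝ))
    (hp_upper : (fun n : ℕ => (n : ℝ) * (p n : ℝ)) =o[atTop] fun n : ℕ => (n : ℝ) ^ (2 / 3 : ℝ))
    -- `N n ℓ` is the number of trials of the `ℓ`-th binomial: `z_ℓ`, rounded up or down
    (N : ℕ → ℕ → ℕ)
    (hN : ∀ n, ∀ ℓ ∈ Finset.Icc 1 (2 * MaxBinomial.k n (p n)),
      MaxBinomial.IsRounding (N n ℓ) (MaxBinomial.z n (p n) ℓ))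
    {Ω : ℕ → Type*} [∀ n, MeasurableSpace (Ω n)]
    (P : ∀ n, Measure (Ω n)) [∀ n, IsProbabilityMeasure (P n)]
    (Z : ∀ n, ℕ → Ω n → ℕ)
    (hZ_law : ∀ n, ∀ ℓ ∈ Finset.Icc 1 (2 * MaxBinomial.k n (p n)),
      ProbabilityTheory.HasLaw (Z n ℓ) (ProbabilityTheory.binomial (N n ℓ) (p n)) (P n))
    (hZ_indep : ∀ n, ProbabilityTheory.iIndepFun
      (fun ℓ : Finset.Icc 1 (2 * MaxBinomial.k n (p n)) => Z n ℓ) (P n)) :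
    MaxBinomial.TendstoInProbability P
      (fun n ω =>
        ((MaxBinomial.maxUpTo (2 * MaxBinomial.k n (p n)) (Z n) ω : ℝ) - n * (p n : ℝ)) /
          √(n * (p n : ℝ) * Real.log (1 / (n * (p n : ℝ) ^ 3))))
      1 := by
  intro δ hδ
  have hsq := MaxBinomial.eventually_rpow_le_mul_sq hε.1 hp_lower
  have hsq_top := MaxBinomial.tendsto_mul_sq hsq
  have hcube := MaxBinomial.tendsto_mul_cube hp_upper
  have hpos : ∀ᶠ n : ℕ in atTop, 0 < (p n : ℝ) := by
    filter_upwards [hsq_top.eventually_ge_atTop 1] with n hn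
    refine lt_of_le_of_ne (p n).2.1 fun h => ?_
    rw [← h] at hn
    norm_num at hn
  -- Once `np² ≥ 1`, `p ≤ np³`.
  have hp : Tendsto (fun n => (p n : ℝ)) atTop (𝓝 0) := by
    refine tendsto_of_tendsto_of_tendsto_of_le_of_le' tendsto_const_nhds hcube
      (Eventually.of_forall fun n => (p n).2.1) ?_
    filter_upwards [hsq_top.eventually_ge_atTop 1] with n hn
    nlinarith [mul_le_mul_of_nonneg_left hn (p n).2.1]
  set L : ℕ → ℝ := fun n => Real.log (1 / (n * (p n : ℝ) ^ 3)) with hLdef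
  have hL : Tendsto L atTop atTop := by
    refine Real.tendsto_log_atTop.comp ?_
    simp only [one_div]
    refine (tendsto_nhdsWithin_iff.2 ⟨hcube, ?_⟩).inv_tendsto_nhdsGT_zero
    filter_upwards [hpos, eventually_gt_atTop 0] with n hn hn0
    have : (0 : ℝ) < n := by exact_mod_cast hn0
    exact Set.mem_Ioi.2 (by positivity)
  set τ : ℕ → ℝ := fun n => √(L n / (n * p n)) with hτdef
  have hτ : Tendsto τ atTop (𝓝 0) := by
    have : Tendsto (fun n : ℕ => 1 / ((n : ℝ) * (p n : ℝ) ^ 2)) atTop (𝓝 0) := by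
      simp only [one_div]
      exact hsq_top.inv_tendsto_atTop
    refine tendsto_of_tendsto_of_tendsto_of_le_of_le' tendsto_const_nhds this
      (Eventually.of_forall fun n => Real.sqrt_nonneg _) ?_
    filter_upwards [hpos, eventually_gt_atTop 0] with n hn hn0
    exact MaxBinomial.sqrt_log_div_le hn0 hn
  -- Below, `h` satisfies `3h < δ` and `h ≤ 1/3`; `c` is the error allowance of `le_binomial_tail`,
  -- and `c ≤ δ/2` keeps half of the upper-tail exponent `δL`.
  have hK := MaxBinomial.tendsto_two_mul_k_mul hsq hpos hp
  set h : ℝ := min δ 1 / 4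
  have hh0 : 0 < h := by have : 0 < min δ 1 := lt_min hδ one_pos; positivity
  have hh1 : h ≤ 1 / 4 := by have := min_le_right δ 1; simp only [h]; linarith
  have hhδ : h ≤ δ / 4 := by have := min_le_left δ 1; simp only [h]; linarith
  set c : ℝ := h ^ 2 / 8
  have hc0 : 0 < c := by positivity
  have hcδ : c ≤ δ / 2 := by simp only [c]; nlinarith
  have hbound : Tendsto (fun n => ENNReal.ofReal
      (3 * Real.exp (-(δ / 2 * L n)) + Real.exp (-(Real.exp (h / 2 * L n) / 4))))
      atTop (𝓝 0) := by
    rw [← ENNReal.ofReal_zero]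
    refine ENNReal.tendsto_ofReal ?_
    have h1 : Tendsto (fun n => Real.exp (-(δ / 2 * L n))) atTop (𝓝 0) :=
      Real.tendsto_exp_neg_atTop_nhds_zero.comp (hL.const_mul_atTop (by positivity))
    have h2 : Tendsto (fun n => Real.exp (-(Real.exp (h / 2 * L n) / 4))) atTop (𝓝 0) :=
      Real.tendsto_exp_neg_atTop_nhds_zero.comp ((Real.tendsto_exp_atTop.comp
        (hL.const_mul_atTop (by positivity))).atTop_div_const (by norm_num))
    simpa using (h1.const_mul 3).add h2
  refine tendsto_of_tendsto_of_tendsto_of_le_of_le' tendsto_const_nhds hbound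
    (Eventually.of_forall fun n => bot_le) ?_
  have hlog : ∀ᶠ n : ℕ in atTop, 1 ≤ Real.log n :=
    (Real.tendsto_log_atTop.comp tendsto_natCast_atTop_atTop).eventually_ge_atTop 1
  filter_upwards [hpos, eventually_gt_atTop 0, hlog, hsq_top.eventually_ge_atTop 1,
    hL.eventually_ge_atTop 2, hL.eventually_ge_atTop (8 / h ^ 2),
    hL.eventually_ge_atTop ((16 / c) ^ 2), hτ.eventually_le_const (show 0 < c / 16 by positivity),
    hτ.eventually_le_const (show (0 : ℝ) < 1 / 2 by norm_num),
    hp.eventually_le_const (show 0 < c / 32 by positivity),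
    hK.eventually_le_const one_pos]
    with n hp0 hn0 hlogn hsqn hL2 hLh hLc hτc hτ2 hpc hKn
  have hn : (0 : ℝ) < n := by exact_mod_cast hn0
  have hp1 := (p n).2.2
  set μ : ℝ := n * p n with hμ
  have hμ1 : 1 ≤ μ := by nlinarith
  have hμ0 : 0 < μ := by linarith
  have hLτ : L n = μ * τ n ^ 2 := by
    rw [hτdef, Real.sq_sqrt (by positivity), ← hμ, mul_div_cancel₀ _ hμ0.ne']
  have hτ0 : 0 < τ n := Real.sqrt_pos.2 (by positivity)
  have hexp : Real.exp (L n) = 1 / (n * (p n : ℝ) ^ 3) := Real.exp_log (by positivity)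
  have hpμ : p n * √μ = Real.exp (-(L n / 2)) := by
    rw [← neg_div, Real.exp_half, Real.exp_neg, hexp, one_div, inv_inv,
      MaxBinomial.mul_sqrt_eq_sqrt_sq_mul hp0.le, hμ]
    congr 1
    ring
  have hKL : Real.exp (L n / 2) ≤ ((2 * MaxBinomial.k n (p n) : ℕ) : ℝ) := by
    rw [Real.exp_half, hexp]
    exact MaxBinomial.sqrt_le_two_mul_k hlogn hp0 hp1
  have hs : √(μ * L n) = μ * τ n := by
    rw [hLτ, ← Real.sqrt_sq (show 0 ≤ μ * τ n by positivity)]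
    congr 1
    ring
  have hsL : 16 ≤ c * √(L n) := by
    have := Real.le_sqrt_of_sq_le hLc
    rwa [div_le_iff₀' hc0] at this
  have hup : L n * τ n + 2 * τ n ≤ c * L n := by nlinarith
  have hlow : 4 * √(L n) + 8 * p n * L n ≤ c * L n := by
    have h1 := Real.mul_self_sqrt (show 0 ≤ L n by linarith)
    have h2 : 16 * √(L n) ≤ c * L n := by
      nlinarith [mul_le_mul_of_nonneg_right hsL (Real.sqrt_nonneg (L n))]
    have h3 : p n * L n ≤ c / 32 * L n := by gcongr
    have h4 : 0 ≤ c * L n := by positivity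
    linarith
  have U := MaxBinomial.measureReal_le_maxUpTo_le (hN n) (hZ_law n) hKn hμ hμ0 hτ0 hτ2 hLτ
    (by linarith) hpμ hδ
  have V := MaxBinomial.measureReal_maxUpTo_lt_le (hN n) (hZ_law n) (hZ_indep n) hKn hμ hμ1 hτ0
    hτ2 hLτ hL2 hpμ hKL hh0 (by linarith) ((div_le_iff₀ (by positivity)).1 hLh) hup hlow
  rw [← ofReal_measureReal]
  refine ENNReal.ofReal_le_ofReal ?_
  have hs0 : 0 < μ * τ n := by positivity
  refine (measureReal_mono (fun ω hω => ?_) (measure_ne_top _ _)).trans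
    ((measureReal_union_le _ _).trans (add_le_add (U.trans ?_) (V.trans (le_of_eq ?_))))
  · change δ ≤ |(_ - μ) / √(μ * L n) - 1| at hω
    rw [hs] at hω
    rcases le_abs.1 hω with hω | hω
    · left
      have : 1 + δ ≤ ((MaxBinomial.maxUpTo (2 * MaxBinomial.k n (p n)) (Z n) ω : ℝ) - μ) /
        (μ * τ n) := by linarith
      rw [le_div_iff₀ hs0] at this
      change μ + (1 + δ) * (μ * τ n) ≤ _
      linarith
    · right
      have : ((MaxBinomial.maxUpTo (2 * MaxBinomial.k n (p n)) (Z n) ω : ℝ) - μ) /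
        (μ * τ n) < 1 - 3 * h := by linarith
      rw [div_lt_iff₀ hs0] at this
      change _ < μ + (1 - 3 * h) * (μ * τ n)
      linarith
  · gcongr
    nlinarith
  · ring_nf
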